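/- **Theorem 3.2.** Conventions. A geodesic metric space $X$ is $\delta$-hyperbolic if in every geodesic triangle each side lies in the closed $\delta$-neighbourhood of the union of the other two. If $X$ is moreover proper (closed bounded sets are compact), $\partial X$ is the set of geodesic rays $[0,\infty)\to X$ modulo finite Hausdorff distance, and $\partial^3X$ is the set of triples of pairwise distinct points of $\partial X$. For $D\in\mathbb R$, a point $x\in X$ is a $D$-barycenter of $\xi=(\xi_1,\xi_2,\xi_3)\in\partial^3X$ if it is at distance at most $D$ from every geodesic line joining $\xi_i$ and $\xi_j$, for all $i\neq j$. Fix a function $\delta\mapsto D(\delta)\in\mathbb R$. A barycenter map of a $\delta$-hyperbolic $X$ is any map $\mathrm{Bary}_X:\partial^3X\to X$ sending each $\xi$ to one of its $D(\delta)$-barycenters (such maps exist as soon as $D(\delta)$ is large enough in terms of $\delta$ alone). A map $f:A\to X$ is $L$-coarsely surjective if every point of $X$ is at distance at most $L$ from some point of $f(A)$. A map $f:Y\to X$ is a $K$-quasiisometric embedding if $\frac1K d(y,y')-K\le d(f(y),f(y'))\le K d(y,y')+K$ for all $y,y'\in Y$. The trivalent tree $T_3$ is the metric graph, with edges of length $1$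 and the path metric, of the tree all of whose vertices have exactly three neighbours; $V(T_3)$ is its set of vertices. Statement. For all $\delta\ge 0$ and $L\ge 0$ there is a constant $K=K(\delta,L)\ge 1$, depending only on $\delta$ and $L$ (and on the fixed function $D$), such that the following holds. Let $X$ be a proper $\delta$-hyperbolic geodesic metric space with an $L$-coarsely surjective barycenter map $\mathrm{Bary}_X:\partial^3X\to X$, and let $x_0\in X$. Then there is a $K$-quasiisometric embedding $\phi:T_3\to X$ such that 1. $\phi(v_0)=x_0$ for some $v_0\in V(T_3)$, and $\phi(u)\ne\phi(v)$ for all distinct $u,v\in V(T_3)$; 2. for all distinct $u,v\in V(T_3)$ we have $\mathrm{Bary}_X^{-1}(\phi(u))\cap \mathrm{Bary}_X^{-1}(\phi(v))=\emptyset$, and, more strongly, no $\xi\in\partial^3X$ has both $\phi(u)$ and $\phi(v)$ as $D(\delta)$-barycenters. Moreover the images of the vertices can be realized as distinct barycenters: one can choose $\xi_v\in\partial^3X$ for $v\in V(T_3)$ such that $d(\phi(v),\mathrm{Bary}_X(\xi_v))\le L$ for every $v$ and the points $\mathrm{Bary}_X(\xi_v)$ are pairwise distinct. -/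

import Mathlib

open scoped NNReal unitInterval

/-! ### Coarse maps -/

/-- `f` is `C`-coarsely surjective: the (closed) `C`-neighbourhood of its image is everything. -/
def CoarselySurjective {A Y : Type*} [MetricSpace Y] (C : ℝ) (f : A → Y) : Prop :=
  ∀ y : Y, ∃ a : A, dist y (f a) ≤ C

/-- `k`-quasiisometric embedding, that is, a `(k, k)`-quasiisometric embedding. -/
def IsQIEmbedding {Y X : Type*} [MetricSpace Y] [MetricSpace X] (k : ℝ) (f : Y → X) : Prop :=
  ∀ y y' : Y, (1 / k) * dist y y' - k ≤ dist (f y) (f y') ∧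
    dist (f y) (f y') ≤ k * dist y y' + k

/-! ### Hyperbolic geodesic spaces -/

section Hyperbolic

variable (X : Type*) [MetricSpace X]

/-- `S` is a geodesic segment joining `x` and `y`: the image of an isometrically embedded
interval `[0, d(x, y)]` that starts at `x` and ends at `y`. -/
def IsGeodesicSegment {X : Type*} [MetricSpace X] (S : Set X) (x y : X) : Prop :=
  ∃ c : ℝ → X, c 0 = x ∧ c (dist x y) = y ∧
    (∀ s ∈ Set.Icc 0 (dist x y), ∀ t ∈ Set.Icc 0 (dist x y), dist (c s) (c t) = |s - t|) ∧
    S = c '' Set.Icc 0 (dist x y)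

/-- Any two points are joined by a geodesic segment. -/
def IsGeodesicSpace : Prop :=
  ∀ x y : X, ∃ S : Set X, IsGeodesicSegment S x y

/-- `δ`-hyperbolic geodesic space: every geodesic triangle is `δ`-slim, that is, each side lies
in the `δ`-neighbourhood of the union of the two other sides. -/
def IsHyperbolic (δ : ℝ) : Prop :=
  IsGeodesicSpace X ∧
  ∀ (x y z : X) (A B C : Set X),
    IsGeodesicSegment A x y → IsGeodesicSegment B y z → IsGeodesicSegment C x z →
    ∀ p ∈ A, ∃ q ∈ B ∪ C, dist p q ≤ δ

/-! ### Geodesic boundary -/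

/-- Geodesic rays `[0, ∞) → X`. -/
def GeodesicRay : Type _ := {c : ℝ≥0 → X // Isometry c}

/-- Geodesic lines `ℝ → X`. -/
def GeodesicLine : Type _ := {c : ℝ → X // Isometry c}

/-- Two rays are related when their images are at finite Hausdorff distance. -/
instance GeodesicRay.setoid : Setoid (GeodesicRay X) where
  r α β := Metric.hausdorffEDist (Set.range α.1) (Set.range β.1) ≠ ⊤
  iseqv :=
    { refl := fun α => by simp
      symm := fun {α β} h => by rwa [Metric.hausdorffEDist_comm]
      trans := fun {α β γ} h₁ h₂ =>
        ne_top_of_le_ne_top (ENNReal.add_ne_top.2 ⟨h₁, h₂⟩) Metric.hausdorffEDist_triangle }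

/-- The geodesic boundary `∂X`. -/
def GeodesicBoundary : Type _ := Quotient (GeodesicRay.setoid X)

variable {X}

/-- The half `t ↦ β t`, `t ≥ 0`, of a line. -/
def GeodesicLine.posRay (β : GeodesicLine X) : GeodesicRay X :=
  ⟨fun t => β.1 t, β.2.comp (Isometry.of_dist_eq fun _ _ => rfl)⟩

/-- The half `t ↦ β (-t)`, `t ≥ 0`, of a line. -/
def GeodesicLine.negRay (β : GeodesicLine X) : GeodesicRay X :=
  ⟨fun t => β.1 (-t), β.2.comp (Isometry.of_dist_eq fun s t => by
    rw [dist_neg_neg]; rfl)⟩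

/-- The line `β` joins `ξ` and `η`: `β(-∞) = ξ` and `β(∞) = η`. -/
def GeodesicLine.Joins (β : GeodesicLine X) (ξ η : GeodesicBoundary X) : Prop :=
  (Quotient.mk _ β.negRay : GeodesicBoundary X) = ξ ∧
  (Quotient.mk _ β.posRay : GeodesicBoundary X) = η

variable (X) in
/-- `∂³X`: triples of pairwise distinct boundary points. -/
def BoundaryTriple : Type _ := {ξ : Fin 3 → GeodesicBoundary X // Function.Injective ξ}

/-- `x` is a `D`-barycenter of the ideal triangle with vertices `ξ₁, ξ₂, ξ₃`: it is `D`-close to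
every geodesic line joining two of the three points. -/
def IsBarycenter (D : ℝ) (ξ : BoundaryTriple X) (x : X) : Prop :=
  ∀ i j : Fin 3, i ≠ j → ∀ β : GeodesicLine X, β.Joins (ξ.1 i) (ξ.1 j) →
    ∃ t : ℝ, dist x (β.1 t) ≤ D

/-- `Bary : ∂³X → X` is a barycenter map (with constant `D`): it sends each triple to one of its
`D`-barycenters. -/
def IsBarycenterMap (D : ℝ) (Bary : BoundaryTriple X → X) : Prop :=
  ∀ ξ : BoundaryTriple X, IsBarycenter D ξ (Bary ξ)

end Hyperbolic

/-! ### Metric graphs -/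

namespace SimpleGraph

variable {V : Type*} (G : SimpleGraph V)

/-- A pair `⟨e, t⟩` stands for the point of the oriented edge `e` at distance `t` from its
initial vertex and `1 - t` from its terminal vertex. -/
structure EdgePoint (hG : G.Connected) where
  /-- the oriented edge -/
  edge : G.Dart
  /-- the position on the edge, in `[0, 1]` -/
  pos : I

namespace EdgePoint

variable {G} {hG : G.Connected}

/-- Distance from a point of an edge to a vertex. -/
noncomputable def toVertex (p : EdgePoint G hG) (w : V) : ℝ :=
  min ((p.pos : ℝ) + G.dist p.edge.fst w) ((1 - p.pos : ℝ) + G.dist p.edge.snd w)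

open Classical in
/-- The path distance between points of edges of length one. On a common edge it is the distance
of the parameters; otherwise a shortest path from `p` runs to a vertex of the edge of `q` and from
there along this edge. -/
noncomputable def pathDist (p q : EdgePoint G hG) : ℝ :=
  if p.edge = q.edge then |(p.pos : ℝ) - q.pos|
  else if p.edge = q.edge.symm then |(p.pos : ℝ) - (1 - q.pos)|
  else min (p.toVertex q.edge.fst + q.pos) (p.toVertex q.edge.snd + (1 - q.pos))

/-- The same point, with the edge traversed in the opposite direction. -/
def flip (p : EdgePoint G hG) : EdgePoint G hG := ⟨p.edge.symm, σ p.pos⟩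

theorem toVertex_flip (p : EdgePoint G hG) (w : V) : p.flip.toVertex w = p.toVertex w := by
  simp [toVertex, flip, min_comm]

theorem pathDist_same {p q : EdgePoint G hG} (h : p.edge = q.edge) :
    p.pathDist q = |(p.pos : ℝ) - q.pos| := by
  simp [pathDist, h]

theorem pathDist_far {p q : EdgePoint G hG} (h : p.edge ≠ q.edge) (h' : p.edge ≠ q.edge.symm) :
    p.pathDist q = min (p.toVertex q.edge.fst + q.pos) (p.toVertex q.edge.snd + (1 - q.pos)) := by
  simp [pathDist, h, h']

theorem pathDist_flip_right (p q : EdgePoint G hG) : p.pathDist q.flip = p.pathDist q := by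
  by_cases h : p.edge = q.edge
  · have h' : p.edge ≠ q.edge.symm := fun e => q.edge.symm_ne (e.symm.trans h)
    simp [pathDist, flip, h, q.edge.symm_ne.symm]
  · by_cases h' : p.edge = q.edge.symm
    · simp [pathDist, flip, h', q.edge.symm_ne]
    · simp [pathDist, flip, h, h', min_comm]

theorem pathDist_comm (p q : EdgePoint G hG) : p.pathDist q = q.pathDist p := by
  by_cases h : p.edge = q.edge
  · rw [pathDist_same h, pathDist_same h.symm, abs_sub_comm]
  · by_cases h' : p.edge = q.edge.symm
    · rw [← pathDist_flip_right, pathDist_same (by exact h')]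
      rw [pathDist, if_neg (Ne.symm h), if_pos (by rw [h']; simp)]
      simp only [flip, unitInterval.coe_symm_eq]
      congr 1; ring
    · rw [pathDist_far h h', pathDist_far (Ne.symm h) (fun e => h' (by rw [e]; simp))]
      simp only [toVertex, ← min_add_add_right]
      rw [min_min_min_comm, G.dist_comm (u := p.edge.fst), G.dist_comm (u := p.edge.snd),
        G.dist_comm (u := p.edge.fst), G.dist_comm (u := p.edge.snd)]
      congr 2 <;> ring

theorem toVertex_lip_same {p q : EdgePoint G hG} (h : p.edge = q.edge) (w : V) :
    p.toVertex w ≤ |(p.pos : ℝ) - q.pos| + q.toVertex w := by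
  have h1 := le_abs_self ((p.pos : ℝ) - q.pos)
  have h2 := neg_abs_le ((p.pos : ℝ) - q.pos)
  simp only [toVertex, h]
  rcases min_choice ((q.pos : ℝ) + G.dist q.edge.fst w) ((1 - q.pos : ℝ) + G.dist q.edge.snd w) with e | e
  · rw [e]
    exact (min_le_left _ _).trans (by linarith)
  · rw [e]
    exact (min_le_right _ _).trans (by linarith)

theorem toVertex_triangle (p : EdgePoint G hG) (u w : V) :
    p.toVertex w ≤ p.toVertex u + G.dist u w := by
  have h1 : (G.dist p.edge.fst w : ℝ) ≤ G.dist p.edge.fst u + G.dist u w :=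
    mod_cast hG.dist_triangle
  have h2 : (G.dist p.edge.snd w : ℝ) ≤ G.dist p.edge.snd u + G.dist u w :=
    mod_cast hG.dist_triangle
  simp only [toVertex, ← min_add_add_right]
  exact min_le_min (by linarith) (by linarith)

/-- The length of a shortest path from `p` to `q` through a vertex of the edge of `q`. -/
noncomputable def farDist (p q : EdgePoint G hG) : ℝ :=
  min (p.toVertex q.edge.fst + q.pos) (p.toVertex q.edge.snd + (1 - q.pos))

theorem farDist_flip_right (p q : EdgePoint G hG) : p.farDist q.flip = p.farDist q := by
  simp [farDist, flip, min_comm]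

theorem dist_ends (p : EdgePoint G hG) : (G.dist p.edge.fst p.edge.snd : ℝ) = 1 :=
  mod_cast SimpleGraph.dist_eq_one_iff_adj.2 p.edge.adj

theorem pathDist_le_farDist (p q : EdgePoint G hG) : p.pathDist q ≤ p.farDist q := by
  have key : ∀ p q : EdgePoint G hG, p.edge = q.edge → p.pathDist q ≤ p.farDist q := by
    intro p q h
    have := p.pos.2.1
    have := p.pos.2.2
    have := q.pos.2.1
    have := q.pos.2.2
    have h1 := dist_ends q
    have h2 := h1
    rw [G.dist_comm] at h2
    rw [pathDist_same h, farDist, toVertex, toVertex, h, h1, h2, SimpleGraph.dist_self,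
      SimpleGraph.dist_self, abs_le]
    simp only [← min_add_add_right, le_min_iff, neg_le]
    push_cast
    constructor <;> refine ⟨⟨?_, ?_⟩, ?_, ?_⟩ <;> linarith
  by_cases h : p.edge = q.edge
  · exact key p q h
  · by_cases h' : p.edge = q.edge.symm
    · rw [← pathDist_flip_right, ← farDist_flip_right]
      exact key p q.flip h'
    · rw [pathDist_far h h', farDist]

theorem pathDist_triangle_same {p q : EdgePoint G hG} (h : p.edge = q.edge) (r : EdgePoint G hG) :
    p.pathDist r ≤ p.pathDist q + q.pathDist r := by
  have key : ∀ r : EdgePoint G hG, q.edge = r.edge → p.pathDist r ≤ p.pathDist q + q.pathDist r := by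
    intro r hr
    rw [pathDist_same h, pathDist_same hr, pathDist_same (h.trans hr)]
    exact abs_sub_le _ _ _
  by_cases hr : q.edge = r.edge
  · exact key r hr
  · by_cases hr' : q.edge = r.edge.symm
    · rw [← pathDist_flip_right p r, ← pathDist_flip_right q r]
      exact key r.flip hr'
    · refine (pathDist_le_farDist p r).trans ?_
      rw [pathDist_same h, pathDist_far hr hr', farDist, ← min_add_add_left]
      have h1 := toVertex_lip_same h r.edge.fst
      have h2 := toVertex_lip_same h r.edge.snd
      exact min_le_min (by linarith) (by linarith)

theorem pathDist_flip_left (p q : EdgePoint G hG) : p.flip.pathDist q = p.pathDist q := by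
  rw [pathDist_comm, pathDist_flip_right, pathDist_comm]

theorem pathDist_triangle_near {p q : EdgePoint G hG} (h : p.edge = q.edge ∨ p.edge = q.edge.symm)
    (r : EdgePoint G hG) : p.pathDist r ≤ p.pathDist q + q.pathDist r := by
  rcases h with h | h
  · exact pathDist_triangle_same h r
  · rw [← pathDist_flip_right p q, ← pathDist_flip_left q r]
    exact pathDist_triangle_same (q := q.flip) h r

theorem pathDist_triangle (p q r : EdgePoint G hG) :
    p.pathDist r ≤ p.pathDist q + q.pathDist r := by
  by_cases h : p.edge = q.edge ∨ p.edge = q.edge.symm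
  · exact pathDist_triangle_near h r
  by_cases h' : r.edge = q.edge ∨ r.edge = q.edge.symm
  · rw [pathDist_comm p r, pathDist_comm p q, pathDist_comm q r, add_comm]
    exact pathDist_triangle_near h' p
  push Not at h h'
  refine (pathDist_le_farDist p r).trans ?_
  have hq : ∀ w, p.toVertex w ≤ p.pathDist q + q.toVertex w := by
    intro w
    have t0 := q.pos.2.1
    have t1 := q.pos.2.2
    have e1 := dist_ends q
    have e2 := e1
    rw [G.dist_comm] at e2
    have a1 := toVertex_triangle p q.edge.fst w
    have a2 := toVertex_triangle p q.edge.snd w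
    have a3 := toVertex_triangle p q.edge.fst q.edge.snd
    have a4 := toVertex_triangle p q.edge.snd q.edge.fst
    rw [e1] at a3
    rw [e2] at a4
    rw [pathDist_far h.1 h.2]
    simp only [toVertex.eq_1 q]
    rcases min_choice (p.toVertex q.edge.fst + q.pos) (p.toVertex q.edge.snd + (1 - q.pos)) with e | e <;>
    rcases min_choice ((q.pos : ℝ) + G.dist q.edge.fst w) ((1 - q.pos : ℝ) + G.dist q.edge.snd w)
      with f | f <;> rw [e, f] <;> linarith
  rw [pathDist_far (p := q) (q := r) (Ne.symm h'.1) (fun e => h'.2 (by rw [e]; simp)), farDist,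
    ← min_add_add_left]
  have h1 := hq r.edge.fst
  have h2 := hq r.edge.snd
  exact min_le_min (by linarith) (by linarith)

noncomputable instance : PseudoMetricSpace (EdgePoint G hG) where
  dist := pathDist
  dist_self p := by simp [pathDist]
  dist_comm := pathDist_comm
  dist_triangle := pathDist_triangle

end EdgePoint

/-- The metric graph of a connected graph with at least one edge: the union of its edges, each of
length one, with the path metric. Points of edges at distance zero (a point and the same point of
the reversed edge, or a common vertex of two edges) are identified. -/
abbrev MetricGraph (hG : G.Connected) : Type _ := SeparationQuotient (EdgePoint G hG)

/-- The vertices of the metric graph, that is, the initial points of its oriented edges. -/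
def MetricGraph.vertices (hG : G.Connected) : Set (MetricGraph G hG) :=
  {x | ∃ e : G.Dart, x = SeparationQuotient.mk (⟨e, 0⟩ : EdgePoint G hG)}

/-- `G` is a trivalent tree: a tree all of whose vertices have exactly three neighbours. -/
def IsTrivalentTree : Prop :=
  G.IsTree ∧ ∀ v : V, (G.neighborSet v).ncard = 3

end SimpleGraph

/-!
The tree is built from finitely many points at a time, and all estimates are phrased with Gromov
products `(x | y)_w` and the four-point condition, which slim triangles imply with constant `3 * δ`
(`IsHyperbolic.fourPointCondition`).

Seen from a barycenter `x` of an ideal triangle, points far out on rays to the three ideal vertices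
have small pairwise Gromov products: each pair is close to the two ends of a line that passes near
`x` (`IsBarycenter.eventually_gromovProduct_le`). Such a line exists for any two distinct boundary
points (`IsHyperbolic.exists_joins`); without it the definition of a barycenter could be vacuous.
This has two consequences. Barycenters of one ideal triangle are uniformly close to each other
(`IsBarycenter.dist_le`). And since every point of `X` is within `L` of a barycenter, at every point
there are three different directions, represented by points at any prescribed distance `R`
(`IsBarycenter.exists_tripod`); by the four-point condition one of the three can be traded for the
direction one comes from (`FourPointCondition.exists_tripod_apply_eq`).

Walking outwards from `x₀` along the tree, `SimpleGraph.IsTree.exists_map_of_stars` places the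
vertices so that adjacent ones are at distance `R` and the neighbours of a vertex lie in different
directions. For large `R` the local-to-global principle `FourPointCondition.mul_le_dist` makes this
map of the vertices expanding, hence quasi-isometric. Choosing `R` large also makes distinct
vertices so far apart that they cannot be barycenters of one triangle, and that barycenters
`L`-close to them are distinct. Points inside edges are sent to the image of a nearby vertex.
-/

/-! ### Gromov products and the four-point condition -/

section GromovProduct

variable {X : Type*} [MetricSpace X]

/-- The Gromov product `(x | y)_w`. -/
noncomputable def gromovProduct (w x y : X) : ℝ := (dist w x + dist w y - dist x y) / 2

theorem gromovProduct_comm (w x y : X) : gromovProduct w x y = gromovProduct w y x := by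
  simp only [gromovProduct, dist_comm x y]; ring

theorem gromovProduct_le_left (w x y : X) : gromovProduct w x y ≤ dist w x := by
  have := dist_triangle w x y
  simp only [gromovProduct]; linarith

theorem gromovProduct_add_gromovProduct (w x y : X) :
    gromovProduct w x y + gromovProduct x w y = dist w x := by
  simp only [gromovProduct, dist_comm x w]; ring

theorem gromovProduct_le_add_dist (w w' x y : X) :
    gromovProduct w x y ≤ gromovProduct w' x y + dist w w' := by
  have h1 := dist_triangle w w' x
  have h2 := dist_triangle w w' y
  simp only [gromovProduct]; linarith

theorem gromovProduct_le_dist_of_dist_add_eq {w x y m : X} (h : dist x m + dist m y = dist x y) :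
    gromovProduct w x y ≤ dist w m := by
  have h1 := dist_triangle w m x
  have h2 := dist_triangle w m y
  rw [dist_comm m x] at h1
  simp only [gromovProduct]; linarith

/-- Replacing an endpoint by a point between it and the base point does not increase the
Gromov product. -/
theorem gromovProduct_mono_left {w x x' y : X} (h : dist w x' + dist x' x = dist w x) :
    gromovProduct w x' y ≤ gromovProduct w x y := by
  have h1 := dist_triangle_left x y x'
  have h2 := dist_triangle x x' y
  rw [dist_comm x x'] at h2
  simp only [gromovProduct]; linarith

/-- Gromov's four-point condition. -/
def FourPointCondition (X : Type*) [MetricSpace X] (η : ℝ) : Prop :=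
  ∀ w x y z : X, min (gromovProduct w x y) (gromovProduct w y z) ≤ gromovProduct w x z + η

/-- The four-point condition along a chain of four points. -/
theorem FourPointCondition.chain {η : ℝ} (h : FourPointCondition X η) (hη : 0 ≤ η)
    {w a b c d : X} {r : ℝ} (hab : r ≤ gromovProduct w a b) (hbc : r ≤ gromovProduct w b c)
    (hcd : r ≤ gromovProduct w c d) : r ≤ gromovProduct w a d + 2 * η := by
  have h1 := h w a b c
  have h2 := h w a c d
  rcases min_choice (gromovProduct w a b) (gromovProduct w b c) with e | e <;>
  rcases min_choice (gromovProduct w a c) (gromovProduct w c d) with e' | e' <;>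
  rw [e] at h1 <;> rw [e'] at h2 <;> linarith

theorem IsGeodesicSegment.symm {S : Set X} {x y : X} (h : IsGeodesicSegment S x y) :
    IsGeodesicSegment S y x := by
  obtain ⟨c, h0, h1, hc, rfl⟩ := h
  refine ⟨fun t => c (dist x y - t), by simpa using h1, by simpa [dist_comm y x] using h0, ?_, ?_⟩
  · intro s hs t ht
    rw [dist_comm y x] at hs ht
    rw [hc _ ⟨by linarith [hs.2], by linarith [hs.1]⟩ _ ⟨by linarith [ht.2], by linarith [ht.1]⟩,
      abs_sub_comm]
    congr 1; ring
  · ext p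
    rw [dist_comm y x]
    constructor
    · rintro ⟨t, ht, rfl⟩
      exact ⟨dist x y - t, ⟨by linarith [ht.2], by linarith [ht.1]⟩, by simp⟩
    · rintro ⟨t, ht, rfl⟩
      exact ⟨dist x y - t, ⟨by linarith [ht.2], by linarith [ht.1]⟩, by simp⟩

theorem IsGeodesicSegment.dist_add_dist {S : Set X} {x y m : X} (h : IsGeodesicSegment S x y)
    (hm : m ∈ S) : dist x m + dist m y = dist x y := by
  obtain ⟨c, h0, h1, hc, rfl⟩ := h
  obtain ⟨t, ht, rfl⟩ := hm
  have e1 := hc 0 ⟨le_rfl, dist_nonneg⟩ t ht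
  have e2 := hc t ht (dist x y) ⟨dist_nonneg, le_rfl⟩
  rw [h0, zero_sub, abs_neg, abs_of_nonneg ht.1] at e1
  rw [h1, abs_sub_comm, abs_of_nonneg (by linarith [ht.2])] at e2
  rw [e1, e2]; ring

theorem IsGeodesicSegment.left_mem {S : Set X} {x y : X} (h : IsGeodesicSegment S x y) : x ∈ S := by
  obtain ⟨c, h0, h1, hc, rfl⟩ := h
  exact ⟨0, ⟨le_rfl, dist_nonneg⟩, h0⟩

theorem IsGeodesicSegment.isCompact {S : Set X} {x y : X} (h : IsGeodesicSegment S x y) :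
    IsCompact S := by
  obtain ⟨c, h0, h1, hc, rfl⟩ := h
  refine isCompact_Icc.image_of_continuousOn (LipschitzOnWith.continuousOn (K := 1) ?_)
  refine LipschitzOnWith.of_dist_le_mul fun s hs t ht => ?_
  rw [hc s hs t ht, Real.dist_eq]; simp

/-- On a side of a slim triangle there is a point close to both other sides: the distances to these
two sides agree somewhere on the side, and the smaller of the two is at most `δ`. -/
theorem IsHyperbolic.exists_near_both {δ : ℝ} (hX : IsHyperbolic X δ) {x y z : X} {A B C : Set X}
    (hA : IsGeodesicSegment A x y) (hB : IsGeodesicSegment B y z) (hC : IsGeodesicSegment C x z) :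
    ∃ m ∈ A, (∃ b ∈ B, dist m b ≤ δ) ∧ ∃ c ∈ C, dist m c ≤ δ := by
  have hslim := hX.2 x y z A B C hA hB hC
  have hBc := hB.isCompact
  have hCc := hC.isCompact
  have hBn : B.Nonempty := ⟨y, hB.left_mem⟩
  have hCn : C.Nonempty := ⟨x, hC.left_mem⟩
  have hyB := hB.left_mem
  have hxC := hC.left_mem
  obtain ⟨g, h0, h1, hg, rfl⟩ := hA
  have hcont : ContinuousOn g (Set.Icc 0 (dist x y)) := by
    refine LipschitzOnWith.continuousOn (K := 1) (LipschitzOnWith.of_dist_le_mul fun s hs t ht => ?_)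
    rw [hg s hs t ht, Real.dist_eq]; simp
  have hf : ContinuousOn (fun t => Metric.infDist (g t) C - Metric.infDist (g t) B)
      (Set.Icc 0 (dist x y)) :=
    ((Metric.continuous_infDist_pt C).comp_continuousOn hcont).sub
      ((Metric.continuous_infDist_pt B).comp_continuousOn hcont)
  have hmem : (0 : ℝ) ∈ Set.Icc (Metric.infDist (g 0) C - Metric.infDist (g 0) B)
      (Metric.infDist (g (dist x y)) C - Metric.infDist (g (dist x y)) B) := by
    rw [h0, h1, Metric.infDist_zero_of_mem hxC, Metric.infDist_zero_of_mem hyB]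
    constructor
    · have := Metric.infDist_nonneg (x := x) (s := B); linarith
    · have := Metric.infDist_nonneg (x := y) (s := C); linarith
  obtain ⟨t, ht, htt⟩ := intermediate_value_Icc dist_nonneg hf hmem
  have heq : Metric.infDist (g t) C = Metric.infDist (g t) B := sub_eq_zero.1 htt
  obtain ⟨b, hb, hb'⟩ := hBc.exists_infDist_eq_dist hBn (g t)
  obtain ⟨c, hc, hc'⟩ := hCc.exists_infDist_eq_dist hCn (g t)
  have hle : Metric.infDist (g t) B ≤ δ := by
    obtain ⟨q, hq, hqd⟩ := hslim (g t) ⟨t, ht, rfl⟩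
    rcases hq with hq | hq
    · exact (Metric.infDist_le_dist_of_mem hq).trans hqd
    · rw [← heq]; exact (Metric.infDist_le_dist_of_mem hq).trans hqd
  exact ⟨g t, ⟨t, ht, rfl⟩, ⟨b, hb, hb' ▸ hle⟩, c, hc, hc' ▸ heq ▸ hle⟩

/-- In a hyperbolic space the Gromov product measures, up to `2δ`, the distance from the base point
to a geodesic segment. -/
theorem IsHyperbolic.exists_dist_le_gromovProduct {δ : ℝ} (hX : IsHyperbolic X δ) {x z : X}
    {A : Set X} (hA : IsGeodesicSegment A x z) (w : X) :
    ∃ m ∈ A, dist w m ≤ gromovProduct w x z + 2 * δ := by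
  obtain ⟨B, hB⟩ := hX.1 z w
  obtain ⟨C, hC⟩ := hX.1 x w
  obtain ⟨m, hm, ⟨b, hb, hbd⟩, c, hc, hcd⟩ := hX.exists_near_both hA hB hC
  refine ⟨m, hm, ?_⟩
  have e1 := hA.dist_add_dist hm
  have e2 := hB.dist_add_dist hb
  have e3 := hC.dist_add_dist hc
  have t1 := dist_triangle_right w m b
  have t2 := dist_triangle_right w m c
  have t3 := dist_triangle m b z
  have t4 := dist_triangle x c m
  rw [dist_comm b z] at t3
  rw [dist_comm c m] at t4
  rw [dist_comm b w] at e2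
  rw [dist_comm c w] at e3
  simp only [gromovProduct, dist_comm w x, dist_comm w z]
  linarith

/-- Slim triangles imply the four-point condition. -/
theorem IsHyperbolic.fourPointCondition {δ : ℝ} (hX : IsHyperbolic X δ) :
    FourPointCondition X (3 * δ) := by
  intro w x y z
  obtain ⟨A, hA⟩ := hX.1 x z
  obtain ⟨B, hB⟩ := hX.1 z y
  obtain ⟨C, hC⟩ := hX.1 x y
  obtain ⟨m, hm, hmd⟩ := hX.exists_dist_le_gromovProduct hA w
  obtain ⟨q, hq, hqd⟩ := hX.2 x z y A B C hA hB hC m hm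
  have t := dist_triangle w m q
  rcases hq with hq | hq
  · have := gromovProduct_le_dist_of_dist_add_eq (w := w) (hB.dist_add_dist hq)
    rw [gromovProduct_comm] at this
    exact (min_le_right _ _).trans (by linarith)
  · have := gromovProduct_le_dist_of_dist_add_eq (w := w) (hC.dist_add_dist hq)
    exact (min_le_left _ _).trans (by linarith)

/-- Local-to-global principle: a discrete path with long steps and small Gromov products at its
interior points makes linear progress. The Gromov product at `p n` of the start and the next point
stays below `C + η`, so each step gains at least `R - 2 * C - 2 * η`. -/
theorem FourPointCondition.mul_le_dist {η R C : ℝ} (h : FourPointCondition X η)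
    (hη : 0 ≤ η) (hC : 0 ≤ C) (hR : 2 * C + 2 * η < R) (p : ℕ → X) (n : ℕ)
    (hstep : ∀ i < n, dist (p i) (p (i + 1)) = R)
    (hturn : ∀ i, i + 1 < n → gromovProduct (p (i + 1)) (p i) (p (i + 2)) ≤ C) :
    n * (R - 2 * C - 2 * η) ≤ dist (p 0) (p n) := by
  have key : ∀ i, i + 1 < n → gromovProduct (p (i + 1)) (p 0) (p (i + 2)) ≤ C + η := by
    intro i
    induction i with
    | zero => intro hi; linarith [hturn 0 hi]
    | succ i ih =>
      intro hi
      have h1 := h (p (i + 1 + 1)) (p (i + 1)) (p 0) (p (i + 1 + 2))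
      have h2 := hturn (i + 1) hi
      have h3 := ih (by omega)
      have h4 := gromovProduct_add_gromovProduct (p (i + 1)) (p (i + 2)) (p 0)
      rw [hstep (i + 1) (by omega), gromovProduct_comm (p (i + 1))] at h4
      rcases min_le_iff.1 h1 with h5 | h5
      · rw [show i + 1 + 1 = i + 2 from rfl] at *
        linarith
      · linarith
  have main : ∀ i ≤ n, i * (R - 2 * C - 2 * η) ≤ dist (p 0) (p i) := by
    intro i
    induction i with
    | zero => intro _; simp
    | succ i ih =>
      intro hi
      have h1 := ih (by omega)
      push_cast
      rcases i with _ | i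
      · have h2 := hstep 0 (by omega)
        simp only [zero_add] at h2 ⊢
        rw [h2]; push_cast; linarith
      · have h2 := key i (by omega)
        have h3 := hstep (i + 1) (by omega)
        simp only [gromovProduct] at h2
        rw [dist_comm (p (i + 1)) (p 0), show p (i + 2) = p (i + 1 + 1) from rfl] at h2
        push_cast at *
        linarith
  exact main n le_rfl

end GromovProduct

/-! ### Rays, lines and ideal triangles -/

section Boundary

open Filter Topology

variable {X : Type*} [MetricSpace X]

theorem GeodesicRay.dist_eq (α : GeodesicRay X) (s t : ℝ≥0) :
    dist (α.1 s) (α.1 t) = |(s : ℝ) - t| := by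
  rw [α.2.dist_eq]; rfl

theorem GeodesicRay.le_dist (α : GeodesicRay X) (x : X) (t : ℝ≥0) :
    (t : ℝ) - dist x (α.1 0) ≤ dist x (α.1 t) := by
  have h := α.dist_eq 0 t
  have h' := dist_triangle_left (α.1 0) (α.1 t) x
  simp only [NNReal.coe_zero, zero_sub, abs_neg, NNReal.abs_eq] at h
  linarith

theorem GeodesicRay.dist_le (α : GeodesicRay X) (x : X) (t : ℝ≥0) :
    dist x (α.1 t) ≤ t + dist x (α.1 0) := by
  have h := α.dist_eq 0 t
  have h' := dist_triangle x (α.1 0) (α.1 t)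
  simp only [NNReal.coe_zero, zero_sub, abs_neg, NNReal.abs_eq] at h
  linarith

theorem GeodesicRay.le_gromovProduct (α : GeodesicRay X) (x : X) {s t : ℝ≥0} (hst : s ≤ t) :
    (s : ℝ) - dist x (α.1 0) ≤ gromovProduct x (α.1 s) (α.1 t) := by
  have h := α.dist_eq s t
  have h1 := α.le_dist x s
  have h2 := α.le_dist x t
  have hst' : (s : ℝ) ≤ t := hst
  rw [abs_sub_comm, abs_of_nonneg (by linarith)] at h
  simp only [gromovProduct]; linarith

/-- Rays that stay at bounded distance at equal times are equivalent. -/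
theorem GeodesicRay.equiv_of_dist_le {α β : GeodesicRay X} {C : ℝ}
    (h : ∀ t, dist (α.1 t) (β.1 t) ≤ C) :
    (Quotient.mk _ α : GeodesicBoundary X) = Quotient.mk _ β := by
  refine Quotient.sound ?_
  refine ne_top_of_le_ne_top ENNReal.ofReal_ne_top
    (Metric.hausdorffEDist_le_of_mem_edist (r := ENNReal.ofReal C) ?_ ?_)
  · rintro _ ⟨t, rfl⟩
    exact ⟨_, ⟨t, rfl⟩, by rw [edist_dist]; exact ENNReal.ofReal_le_ofReal (h t)⟩
  · rintro _ ⟨t, rfl⟩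
    exact ⟨_, ⟨t, rfl⟩, by
      rw [edist_dist, dist_comm]; exact ENNReal.ofReal_le_ofReal (h t)⟩

/-- Equivalent rays stay at bounded distance at equal times. -/
theorem GeodesicRay.exists_dist_le_of_equiv {α β : GeodesicRay X}
    (h : (Quotient.mk _ α : GeodesicBoundary X) = Quotient.mk _ β) :
    ∃ C, ∀ t, dist (α.1 t) (β.1 t) ≤ C := by
  have h : Metric.hausdorffEDist (Set.range α.1) (Set.range β.1) ≠ ⊤ := Quotient.exact h
  obtain ⟨r, hr⟩ := ENNReal.lt_iff_exists_nnreal_btwn.1 (lt_top_iff_ne_top.2 h)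
  refine ⟨2 * r + dist (α.1 0) (β.1 0), fun t => ?_⟩
  obtain ⟨_, ⟨s, rfl⟩, hs⟩ := Metric.exists_edist_lt_of_hausdorffEDist_lt (Set.mem_range_self t) hr.1
  have hs' : dist (α.1 t) (β.1 s) < r := by
    rw [edist_nndist] at hs; exact_mod_cast hs
  have h1 := β.dist_eq s t
  have h2 := dist_triangle (α.1 t) (β.1 s) (β.1 t)
  have h3 := β.le_dist (α.1 0) s
  have h4 := β.dist_le (α.1 0) s
  have h5 := α.dist_eq 0 t
  simp only [NNReal.coe_zero, zero_sub, abs_neg, NNReal.abs_eq] at h5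
  have h6 := dist_triangle (α.1 0) (α.1 t) (β.1 s)
  have h7 := dist_triangle_right (α.1 0) (α.1 t) (β.1 s)
  have h8 : |(s : ℝ) - t| ≤ r + dist (α.1 0) (β.1 0) := by
    rw [abs_le]; constructor <;> linarith
  linarith

/-- Along equivalent rays the Gromov product tends to infinity. -/
theorem GeodesicRay.tendsto_gromovProduct_of_equiv {α β : GeodesicRay X}
    (h : (Quotient.mk _ α : GeodesicBoundary X) = Quotient.mk _ β) (x : X) :
    Tendsto (fun t => gromovProduct x (α.1 t) (β.1 t)) atTop atTop := by
  obtain ⟨C, hC⟩ := GeodesicRay.exists_dist_le_of_equiv h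
  have h1 : Tendsto (fun t : ℝ≥0 => (t : ℝ) +
      -((dist x (α.1 0) + dist x (β.1 0) + C) / 2)) atTop atTop :=
    tendsto_atTop_add_const_right _ _ (NNReal.tendsto_coe_atTop.2 tendsto_id)
  refine tendsto_atTop_mono (fun t => ?_) h1
  have := hC t
  have := α.le_dist x t
  have := β.le_dist x t
  simp only [gromovProduct]; linarith

/-- Inequivalent rays have bounded Gromov products. -/
theorem FourPointCondition.exists_gromovProduct_le {η : ℝ} (h : FourPointCondition X η) (hη : 0 ≤ η)
    {α β : GeodesicRay X} (hαβ : (Quotient.mk _ α : GeodesicBoundary X) ≠ Quotient.mk _ β) (o : X) :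
    ∃ C, ∀ t, gromovProduct o (α.1 t) (β.1 t) ≤ C := by
  by_contra! hcon
  apply hαβ
  refine GeodesicRay.equiv_of_dist_le
    (C := 3 * dist o (α.1 0) + 3 * dist o (β.1 0) + 4 * η) fun t => ?_
  obtain ⟨n, hn⟩ := hcon (t + dist o (α.1 0) + dist o (β.1 0))
  have hd1 : 0 ≤ dist o (α.1 0) := dist_nonneg
  have hd2 : 0 ≤ dist o (β.1 0) := dist_nonneg
  have hnt : t ≤ n := by
    have h1 := gromovProduct_le_left o (α.1 n) (β.1 n)
    have h2 := α.dist_le o n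
    have : (t : ℝ) ≤ n := by linarith
    exact this
  have h1 := α.le_gromovProduct o hnt
  have h2 := β.le_gromovProduct o hnt
  rw [gromovProduct_comm] at h2
  have h3 := h.chain hη (r := t - dist o (α.1 0) - dist o (β.1 0))
    (by linarith) (by linarith) (by linarith : _ ≤ gromovProduct o (β.1 n) (β.1 t))
    (a := α.1 t)
  have h4 := α.dist_le o t
  have h5 := β.dist_le o t
  simp only [gromovProduct] at h3
  linarith

/-- A geodesic from a point `m` to a point far out on a ray `β` fellow-travels with `β`. -/
theorem FourPointCondition.dist_ray_le {η : ℝ} (h : FourPointCondition X η) (β : GeodesicRay X)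
    {m p : X} {t n : ℝ≥0} (htn : t ≤ n) (hmp : dist m p = t)
    (hp : dist m p + dist p (β.1 n) = dist m (β.1 n)) :
    dist p (β.1 t) ≤ 3 * dist m (β.1 0) + 2 * η := by
  have h1 : gromovProduct m p (β.1 n) = t := by
    simp only [gromovProduct]; linarith
  have h2 := β.le_gromovProduct m htn
  rw [gromovProduct_comm] at h2
  have h3 := h m p (β.1 n) (β.1 t)
  have h4 := β.dist_le m t
  have h5 : 0 ≤ dist m (β.1 0) := dist_nonneg
  have h6 : (t : ℝ) - dist m (β.1 0) ≤
      min (gromovProduct m p (β.1 n)) (gromovProduct m (β.1 n) (β.1 t)) :=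
    le_min (by linarith) h2
  simp only [gromovProduct] at h3 h6
  linarith

/-- Maps `g n` to a proper space that are isometric on larger and larger intervals and keep `g n 0`
in a fixed ball have a pointwise limit along an ultrafilter, and this limit is a geodesic line. -/
theorem exists_geodesicLine_of_eventually_isometric [ProperSpace X] (g : ℕ → ℝ → X) (o : X) (C : ℝ)
    (ho : ∀ n, dist (g n 0) o ≤ C)
    (hg : ∀ s t, ∀ᶠ n in atTop, dist (g n s) (g n t) = |s - t|) :
    ∃ (γ : GeodesicLine X) (U : Ultrafilter ℕ), (U : Filter ℕ) ≤ atTop ∧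
      ∀ t, Tendsto (fun n => g n t) U (𝓝 (γ.1 t)) := by
  have hU : (hyperfilter ℕ : Filter ℕ) ≤ atTop := Nat.hyperfilter_le_atTop
  have hlim : ∀ t, ∃ y, Tendsto (fun n => g n t) (hyperfilter ℕ) (𝓝 y) := by
    intro t
    have hmem : ∀ᶠ n in (hyperfilter ℕ : Filter ℕ), g n t ∈ Metric.closedBall o (|t| + C) := by
      filter_upwards [hU (hg t 0)] with n hn
      rw [sub_zero] at hn
      exact (dist_triangle _ (g n 0) _).trans (add_le_add hn.le (ho n))
    obtain ⟨y, -, hy⟩ := (isCompact_closedBall o (|t| + C)).ultrafilter_le_nhds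
      ((hyperfilter ℕ).map fun n => g n t) (le_principal_iff.2 hmem)
    exact ⟨y, hy⟩
  choose γ hγ using hlim
  refine ⟨⟨γ, Isometry.of_dist_eq fun s t => ?_⟩, hyperfilter ℕ, hU, hγ⟩
  refine tendsto_nhds_unique ((hγ s).dist (hγ t)) ?_
  rw [Real.dist_eq]
  exact tendsto_const_nhds.congr' (by filter_upwards [hU (hg s t)] with n hn using hn.symm)

/-- In a proper hyperbolic space any two distinct boundary points are joined by a geodesic line:
segments between far-out points of representing rays pass near a fixed point, and their limits
fellow-travel with the rays. -/
theorem IsHyperbolic.exists_joins [ProperSpace X] {δ : ℝ} (hδ : 0 ≤ δ) (hX : IsHyperbolic X δ)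
    {ξ ζ : GeodesicBoundary X} (hne : ξ ≠ ζ) : ∃ γ : GeodesicLine X, γ.Joins ξ ζ := by
  induction ξ using Quotient.inductionOn with | _ α
  induction ζ using Quotient.inductionOn with | _ β
  have h4 := hX.fourPointCondition
  set o := α.1 0
  obtain ⟨C, hC⟩ := h4.exists_gromovProduct_le (by linarith) hne o
  have hseg : ∀ n : ℕ, ∃ (c : ℝ → X) (a b : ℝ), a ≤ 0 ∧ 0 ≤ b ∧
      (∀ s ∈ Set.Icc a b, ∀ t ∈ Set.Icc a b, dist (c s) (c t) = |s - t|) ∧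
      c a = α.1 n ∧ c b = β.1 n ∧ dist (c 0) o ≤ C + 2 * δ := by
    intro n
    obtain ⟨S, hS⟩ := hX.1 (α.1 n) (β.1 n)
    obtain ⟨m, hm, hmd⟩ := hX.exists_dist_le_gromovProduct hS o
    obtain ⟨c, h0, h1, hc, rfl⟩ := hS
    obtain ⟨τ, hτ, rfl⟩ := hm
    refine ⟨fun t => c (t + τ), -τ, dist (α.1 n) (β.1 n) - τ, by linarith [hτ.1],
      by linarith [hτ.2], ?_, by simpa using h0, by simpa using h1, ?_⟩
    · intro s hs t ht
      rw [hc _ ⟨by linarith [hs.1], by linarith [hs.2]⟩ _ ⟨by linarith [ht.1], by linarith [ht.2]⟩]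
      congr 1; ring
    · rw [dist_comm]
      simp only [zero_add]
      exact hmd.trans (by linarith [hC n])
  choose g a b ha hb hg hga hgb hgo using hseg
  have hlen : ∀ n : ℕ, (n : ℝ) - (C + 2 * δ) - dist o (β.1 0) ≤ b n ∧
      (n : ℝ) - (C + 2 * δ) ≤ -a n := by
    intro n
    have h1 := hg n (a n) ⟨le_rfl, (ha n).trans (hb n)⟩ 0 ⟨ha n, hb n⟩
    have h2 := hg n 0 ⟨ha n, hb n⟩ (b n) ⟨(ha n).trans (hb n), le_rfl⟩
    rw [sub_zero, abs_of_nonpos (ha n), hga] at h1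
    rw [zero_sub, abs_neg, abs_of_nonneg (hb n), hgb] at h2
    have h3 := α.le_dist (g n 0) n
    have h4 := β.le_dist (g n 0) n
    have h5 := dist_triangle (g n 0) o (β.1 0)
    have h6 := hgo n
    rw [dist_comm (α.1 _)] at h1
    rw [NNReal.coe_natCast] at h3 h4
    constructor <;> linarith
  have hmem : ∀ t : ℝ, ∀ᶠ n : ℕ in atTop, t ∈ Set.Icc (a n) (b n) := by
    intro t
    filter_upwards [tendsto_natCast_atTop_atTop.eventually_ge_atTop
      (|t| + (C + 2 * δ) + dist o (β.1 0))] with n hn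
    have := hlen n
    have := abs_le.1 (le_refl |t|)
    have : 0 ≤ dist o (β.1 0) := dist_nonneg
    constructor <;> linarith
  obtain ⟨γ, U, hU, hγ⟩ := exists_geodesicLine_of_eventually_isometric g o (C + 2 * δ) hgo
    (fun s t => by
      filter_upwards [hmem s, hmem t] with n hs ht using hg n s hs t ht)
  refine ⟨γ, GeodesicRay.equiv_of_dist_le (C := 3 * (C + 2 * δ) + 2 * (3 * δ)) fun t => ?_,
    GeodesicRay.equiv_of_dist_le (C := 3 * (C + 2 * δ + dist o (β.1 0)) + 2 * (3 * δ)) fun t => ?_⟩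
  · refine le_of_tendsto ((hγ (-t)).dist tendsto_const_nhds) (hU ?_)
    filter_upwards [hmem (-t), eventually_ge_atTop ⌈t⌉₊] with n ht hn
    have htn : t ≤ n := Nat.ceil_le.1 hn
    have h0 : (0 : ℝ) ∈ Set.Icc (a n) (b n) := ⟨ha n, hb n⟩
    have h1 := hg n 0 h0 (-t) ht
    have h2 := hg n (-t) ht (a n) ⟨le_rfl, (ha n).trans (hb n)⟩
    have h3 := hg n 0 h0 (a n) ⟨le_rfl, (ha n).trans (hb n)⟩
    rw [sub_neg_eq_add, zero_add, NNReal.abs_eq] at h1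
    rw [abs_of_nonneg (by linarith [ht.1])] at h2
    rw [abs_of_nonneg (by linarith [ha n])] at h3
    rw [hga] at h2 h3
    exact (h4.dist_ray_le α htn h1 (by linarith)).trans (by linarith [hgo n])
  · refine le_of_tendsto ((hγ t).dist tendsto_const_nhds) (hU ?_)
    filter_upwards [hmem t, eventually_ge_atTop ⌈t⌉₊] with n ht hn
    have htn : t ≤ n := Nat.ceil_le.1 hn
    have h0 : (0 : ℝ) ∈ Set.Icc (a n) (b n) := ⟨ha n, hb n⟩
    have h1 := hg n 0 h0 t ht
    have h2 := hg n t ht (b n) ⟨(ha n).trans (hb n), le_rfl⟩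
    have h3 := hg n 0 h0 (b n) ⟨(ha n).trans (hb n), le_rfl⟩
    rw [zero_sub, abs_neg, NNReal.abs_eq] at h1
    rw [abs_sub_comm, abs_of_nonneg (by linarith [ht.2])] at h2
    rw [abs_sub_comm, abs_of_nonneg (by linarith [hb n])] at h3
    rw [hgb] at h2 h3
    exact (h4.dist_ray_le β htn h1 (by linarith)).trans
      (by linarith [hgo n, dist_triangle (g n 0) o (β.1 0)])

/-- Seen from a barycenter, far-out points of rays to two different vertices of an ideal triangle
have small Gromov product, because they are close to the two ends of a line passing near the
barycenter. -/
theorem IsBarycenter.eventually_gromovProduct_le [ProperSpace X] {δ D : ℝ} (hδ : 0 ≤ δ)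
    (hX : IsHyperbolic X δ) {ξ : BoundaryTriple X} {x : X} (hx : IsBarycenter D ξ x)
    {α : Fin 3 → GeodesicRay X} (hα : ∀ i, (Quotient.mk _ (α i) : GeodesicBoundary X) = ξ.1 i)
    {i j : Fin 3} (hij : i ≠ j) :
    ∀ᶠ t in atTop, gromovProduct x ((α i).1 t) ((α j).1 t) ≤ D + 6 * δ := by
  have h4 := hX.fourPointCondition
  obtain ⟨γ, hγi, hγj⟩ := hX.exists_joins hδ (ξ.2.ne hij)
  obtain ⟨τ, hτ⟩ := hx i j hij γ ⟨hγi, hγj⟩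
  have h1 := GeodesicRay.tendsto_gromovProduct_of_equiv (hγi.trans (hα i).symm) x
  have h2 := GeodesicRay.tendsto_gromovProduct_of_equiv ((hα j).trans hγj.symm) x
  filter_upwards [h1.eventually_gt_atTop (D + 6 * δ), h2.eventually_gt_atTop (D + 6 * δ),
    eventually_ge_atTop (Real.toNNReal |τ|)] with t ht1 ht2 ht3
  have ht4 : |τ| ≤ t := Real.toNNReal_le_iff_le_coe.1 ht3
  by_contra! hcon
  have hbetween : gromovProduct x (γ.1 (-t)) (γ.1 t) ≤ D := by
    refine (gromovProduct_le_dist_of_dist_add_eq (m := γ.1 τ) ?_).trans hτ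
    rw [γ.2.dist_eq, γ.2.dist_eq, γ.2.dist_eq, Real.dist_eq, Real.dist_eq, Real.dist_eq]
    have := abs_le.1 ht4
    rw [abs_of_nonpos (by linarith), abs_of_nonpos (by linarith), abs_of_nonpos (by linarith)]
    ring
  have hlt := lt_min ht1 (lt_min hcon ht2)
  set r := min (gromovProduct x (γ.negRay.1 t) ((α i).1 t))
    (min (gromovProduct x ((α i).1 t) ((α j).1 t)) (gromovProduct x ((α j).1 t) (γ.posRay.1 t)))
  have h5 := h4.chain (by linarith) (r := r) (min_le_left _ _)
    ((min_le_right _ _).trans (min_le_left _ _)) ((min_le_right _ _).trans (min_le_right _ _))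
  have h6 : gromovProduct x (γ.negRay.1 t) (γ.posRay.1 t) ≤ D := hbetween
  linarith

/-- Seen from `x`, three points with small pairwise Gromov products lie in different directions,
so `y` shares its direction with at most one of them. -/
theorem FourPointCondition.exists_forall_ne_gromovProduct_le {η C : ℝ} (h : FourPointCondition X η)
    {x : X} {q : Fin 3 → X} (hq : ∀ i j, i ≠ j → gromovProduct x (q i) (q j) ≤ C) (y : X) :
    ∃ i₀, ∀ i ≠ i₀, gromovProduct x (q i) y ≤ C + η := by
  by_contra! hcon
  obtain ⟨i, -, hi⟩ := hcon 0
  obtain ⟨j, hj, hj'⟩ := hcon i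
  have h1 := h x (q i) y (q j)
  rw [gromovProduct_comm x y] at h1
  have h2 := lt_min hi hj'
  linarith [hq i j hj.symm]

/-- Two barycenters of the same ideal triangle are uniformly close. -/
theorem IsBarycenter.dist_le [ProperSpace X] {δ D : ℝ} (hδ : 0 ≤ δ)
    (hX : IsHyperbolic X δ) {ξ : BoundaryTriple X} {x y : X} (hx : IsBarycenter D ξ x)
    (hy : IsBarycenter D ξ y) : dist x y ≤ 2 * D + 18 * δ := by
  have h4 := hX.fourPointCondition
  choose α hα using fun i => Quotient.exists_rep (ξ.1 i)
  have hall : ∀ z, IsBarycenter D ξ z → ∀ᶠ t in atTop, ∀ i j, i ≠ j →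
      gromovProduct z ((α i).1 t) ((α j).1 t) ≤ D + 6 * δ := by
    intro z hz
    simp only [eventually_all]
    exact fun i j hij => hz.eventually_gromovProduct_le hδ hX hα hij
  obtain ⟨t, htx, hty⟩ := ((hall x hx).and (hall y hy)).exists
  obtain ⟨i, hi⟩ := h4.exists_forall_ne_gromovProduct_le htx y
  obtain ⟨j, hj⟩ := h4.exists_forall_ne_gromovProduct_le hty x
  obtain ⟨k, hki, hkj⟩ : ∃ k : Fin 3, k ≠ i ∧ k ≠ j :=
    (by decide : ∀ i j : Fin 3, ∃ k, k ≠ i ∧ k ≠ j) i j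
  have h1 := hi k hki
  have h2 := hj k hkj
  have h3 := gromovProduct_add_gromovProduct x y ((α k).1 t)
  rw [gromovProduct_comm] at h1 h2
  linarith

/-- Near a barycenter there are, at every distance `R`, three points in different directions. -/
theorem IsBarycenter.exists_tripod [ProperSpace X] {δ D L : ℝ} (hδ : 0 ≤ δ)
    (hX : IsHyperbolic X δ) {ξ : BoundaryTriple X} {b x : X} (hb : IsBarycenter D ξ b)
    (hxb : dist x b ≤ L) {R : ℝ} (hR : 0 ≤ R) :
    ∃ q : Fin 3 → X, (∀ i, dist x (q i) = R) ∧
      ∀ i j, i ≠ j → gromovProduct x (q i) (q j) ≤ D + L + 6 * δ := by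
  choose α hα using fun i => Quotient.exists_rep (ξ.1 i)
  have hall : ∀ᶠ t in atTop, ∀ i j, i ≠ j →
      gromovProduct b ((α i).1 t) ((α j).1 t) ≤ D + 6 * δ := by
    simp only [eventually_all]
    exact fun i j hij => hb.eventually_gromovProduct_le hδ hX hα hij
  have hfar : ∀ᶠ t in atTop, ∀ i, R ≤ dist x ((α i).1 t) := by
    rw [eventually_all]
    intro i
    filter_upwards [eventually_ge_atTop (Real.toNNReal (R + dist x ((α i).1 0)))] with t ht
    have := Real.toNNReal_le_iff_le_coe.1 ht
    linarith [(α i).le_dist x t]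
  obtain ⟨t, ht, hfar⟩ := (hall.and hfar).exists
  have hq : ∀ i, ∃ q, dist x q = R ∧ dist x q + dist q ((α i).1 t) = dist x ((α i).1 t) := by
    intro i
    obtain ⟨S, hS⟩ := hX.1 x ((α i).1 t)
    have hS' := hS
    obtain ⟨c, h0, -, hc, rfl⟩ := hS
    have hmem : R ∈ Set.Icc 0 (dist x ((α i).1 t)) := ⟨hR, hfar i⟩
    refine ⟨c R, ?_, hS'.dist_add_dist ⟨R, hmem, rfl⟩⟩
    have := hc 0 ⟨le_rfl, dist_nonneg⟩ R hmem
    rwa [h0, zero_sub, abs_neg, abs_of_nonneg hR] at this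
  choose q hqR hq using hq
  refine ⟨q, hqR, fun i j hij => ?_⟩
  have h1 := gromovProduct_mono_left (y := q j) (hq i)
  have h2 := gromovProduct_mono_left (y := (α i).1 t) (hq j)
  have h3 := gromovProduct_le_add_dist x b ((α i).1 t) ((α j).1 t)
  rw [gromovProduct_comm, gromovProduct_comm x ((α j).1 t)] at h2
  linarith [ht i j hij]

/-- Given three directions at `x`, one of them can be replaced by the direction of any point `y` at
the same distance, and the replaced one can be given any label. -/
theorem FourPointCondition.exists_tripod_apply_eq {η C R : ℝ} (h : FourPointCondition X η)
    (hη : 0 ≤ η) {x : X} {q : Fin 3 → X} (hqR : ∀ i, dist x (q i) = R)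
    (hq : ∀ i j, i ≠ j → gromovProduct x (q i) (q j) ≤ C) {y : X} (hy : dist x y = R) (k : Fin 3) :
    ∃ q' : Fin 3 → X, q' k = y ∧ (∀ i, dist x (q' i) = R) ∧
      ∀ i j, i ≠ j → gromovProduct x (q' i) (q' j) ≤ C + η := by
  obtain ⟨i₀, hi₀⟩ := h.exists_forall_ne_gromovProduct_le hq y
  refine ⟨Function.update (q ∘ Equiv.swap k i₀) k y, by simp, fun i => ?_, fun i j hij => ?_⟩
  · by_cases hi : i = k
    · simp [hi, hy]
    · simp [hi, hqR]
  · have hswap : ∀ i ≠ k, Equiv.swap k i₀ i ≠ i₀ := fun i hi e =>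
      hi ((Equiv.swap k i₀).injective (e.trans (Equiv.swap_apply_left k i₀).symm))
    by_cases hi : i = k
    · have hj : j ≠ k := fun e => hij (hi.trans e.symm)
      subst hi
      rw [Function.update_self, Function.update_of_ne hj, gromovProduct_comm]
      exact hi₀ _ (hswap j hj)
    · by_cases hj : j = k
      · subst hj
        rw [Function.update_self, Function.update_of_ne hi]
        exact hi₀ _ (hswap i hi)
      · rw [Function.update_of_ne hi, Function.update_of_ne hj]
        exact (hq _ _ ((Equiv.swap k i₀).injective.ne hij)).trans (by linarith)

end Boundary

/-! ### Trees and their metric graphs -/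

namespace SimpleGraph

section Tree

variable {V : Type*} {G : SimpleGraph V}

/-- Every vertex other than the root has a parent, a neighbour closer to the root. -/
theorem Connected.exists_adj_dist_add_one_eq (hG : G.Connected) {r v : V} (hv : v ≠ r) :
    ∃ u, G.Adj u v ∧ G.dist r u + 1 = G.dist r v := by
  obtain ⟨p, hp⟩ := hG.exists_walk_length_eq_dist v r
  cases p with
  | nil => exact absurd rfl hv
  | @cons _ u _ h p =>
    refine ⟨u, h.symm, ?_⟩
    have h1 := dist_le p
    have h2 := hG.dist_triangle (u := v) (v := u) (w := r)
    rw [dist_eq_one_iff_adj.2 h] at h2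
    rw [Walk.length_cons] at hp
    rw [dist_comm (u := r), dist_comm (u := r)]
    omega

/-- The parent of a vertex of a rooted tree is unique. -/
theorem IsTree.eq_of_adj_of_dist_add_one_eq (hG : G.IsTree) {r u u' v : V} (hu : G.Adj u v)
    (hu' : G.Adj u' v) (h : G.dist r u + 1 = G.dist r v) (h' : G.dist r u' + 1 = G.dist r v) :
    u = u' := by
  obtain ⟨p, hp⟩ := hG.connected.exists_walk_length_eq_dist r u
  obtain ⟨p', hp'⟩ := hG.connected.exists_walk_length_eq_dist r u'
  have hq : (p.concat hu).IsPath :=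
    Walk.isPath_of_length_eq_dist _ (by rw [Walk.length_concat, hp, h])
  have hq' : (p'.concat hu').IsPath :=
    Walk.isPath_of_length_eq_dist _ (by rw [Walk.length_concat, hp', h'])
  have heq : p.concat hu = p'.concat hu' :=
    (hG.existsUnique_path r v).unique hq hq'
  simpa using congrArg Walk.penultimate heq

/-- Recursive construction of a map `f` on a tree whose edges at `v` carry labels `e v`.
A star at `x` is a labelled family `q` of points with `P x q`; if a star can be erected at every
endpoint of a star so that a prescribed label points back to the centre, then there is a map on the
tree that sends the neighbours of every vertex to endpoints of a star, as the labels say. -/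
theorem IsTree.exists_map_of_stars (hG : G.IsTree) {ι X : Type*} (e : V → V → ι) (r : V) (x₀ : X)
    (P : X → (ι → X) → Prop) (hx₀ : ∃ q, P x₀ q)
    (hext : ∀ x q, P x q → ∀ k k', ∃ q', P (q k) q' ∧ q' k' = x) :
    ∃ f : V → X, f r = x₀ ∧ ∀ v, ∃ q, P (f v) q ∧ ∀ u, G.Adj v u → q (e v u) = f u := by
  obtain ⟨q₀, hq₀⟩ := hx₀
  have hnext : ∀ (s : {s : X × (ι → X) // P s.1 s.2}) (k k' : ι),
      ∃ s' : {s : X × (ι → X) // P s.1 s.2}, s'.1.1 = s.1.2 k ∧ s'.1.2 k' = s.1.1 := by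
    rintro ⟨⟨x, q⟩, hs⟩ k k'
    obtain ⟨q', hq', hk'⟩ := hext x q hs k k'
    exact ⟨⟨⟨q k, q'⟩, hq'⟩, rfl, hk'⟩
  choose next hnext₁ hnext₂ using hnext
  have hpar : ∀ v, ∃ u, v ≠ r → G.Adj u v ∧ G.dist r u + 1 = G.dist r v := by
    intro v
    by_cases hv : v = r
    · exact ⟨v, fun h => absurd hv h⟩
    · obtain ⟨u, hu⟩ := hG.connected.exists_adj_dist_add_one_eq hv
      exact ⟨u, fun _ => hu⟩
  choose par hpar using hpar
  let F : ℕ → V → {s : X × (ι → X) // P s.1 s.2} := fun n =>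
    Nat.rec (fun _ => ⟨⟨x₀, q₀⟩, hq₀⟩)
      (fun _ F v => next (F (par v)) (e (par v) v) (e v (par v))) n
  have hstep : ∀ u v, G.Adj u v → G.dist r v = G.dist r u + 1 →
      F (G.dist r v) v = next (F (G.dist r u) u) (e u v) (e v u) := by
    intro u v huv hd
    have hv : v ≠ r := by
      rintro rfl
      simp at hd
    obtain ⟨h1, h2⟩ := hpar v hv
    have hu : par v = u := hG.eq_of_adj_of_dist_add_one_eq h1 huv h2 hd.symm
    rw [hd]
    change next (F (G.dist r u) (par v)) (e (par v) v) (e v (par v)) = _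
    rw [hu]
  refine ⟨fun v => (F (G.dist r v) v).1.1, ?_, fun v =>
    ⟨(F (G.dist r v) v).1.2, (F (G.dist r v) v).2, fun u hvu => ?_⟩⟩
  · change (F (G.dist r r) r).1.1 = x₀
    rw [dist_self]
    rfl
  · rcases hG.dist_eq_dist_add_one_of_adj r hvu with h | h
    · rw [hstep u v hvu.symm h, hnext₂]
    · dsimp only
      rw [hstep v u hvu h, hnext₁]

/-- The neighbours of each vertex of a trivalent tree can be labelled by `Fin 3`. -/
theorem IsTrivalentTree.exists_label (hG : G.IsTrivalentTree) :
    ∃ e : V → V → Fin 3, ∀ v, Set.InjOn (e v) (G.neighborSet v) := by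
  have h : ∀ v, ∃ e : V → Fin 3, Set.InjOn e (G.neighborSet v) := by
    intro v
    have hcard : Nat.card (G.neighborSet v) = 3 := hG.2 v
    have : Finite (G.neighborSet v) := Nat.finite_of_card_ne_zero (by omega)
    let i := Finite.equivFinOfCardEq hcard
    classical
    refine ⟨fun u => if h : u ∈ G.neighborSet v then i ⟨u, h⟩ else 0, fun u hu w hw huw => ?_⟩
    dsimp only at huw
    rw [dif_pos hu, dif_pos hw] at huw
    exact congrArg Subtype.val (i.injective huw)
  exact ⟨fun v => (h v).choose, fun v => (h v).choose_spec⟩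

theorem IsTrivalentTree.exists_adj (hG : G.IsTrivalentTree) (v : V) : ∃ u, G.Adj v u :=
  Set.nonempty_of_ncard_ne_zero (s := G.neighborSet v) (by rw [hG.2 v]; norm_num)

variable {X : Type*} [MetricSpace X]

theorem Connected.dist_map_le (hG : G.Connected) {f : V → X} {R : ℝ}
    (hf : ∀ u v, G.Adj u v → Dist.dist (f u) (f v) = R) (u v : V) :
    Dist.dist (f u) (f v) ≤ R * G.dist u v := by
  obtain ⟨p, hp⟩ := hG.exists_walk_length_eq_dist u v
  rw [← hp]
  clear hp
  induction p with
  | nil => simp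
  | @cons u w v h p ih =>
    have := _root_.dist_triangle (f u) (f w) (f v)
    rw [hf _ _ h] at this
    rw [Walk.length_cons]
    push_cast
    linarith

/-- Long edges and small Gromov products at the vertices make a map of graphs into a hyperbolic
space expanding. -/
theorem Connected.mul_dist_le_dist_map (hG : G.Connected) {f : V → X} {R C η : ℝ}
    (h : FourPointCondition X η) (hη : 0 ≤ η) (hC : 0 ≤ C) (hR : 2 * C + 2 * η < R)
    (hf : ∀ u v, G.Adj u v → Dist.dist (f u) (f v) = R)
    (hturn : ∀ v u w, G.Adj v u → G.Adj v w → u ≠ w → gromovProduct (f v) (f u) (f w) ≤ C)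
    (u v : V) : G.dist u v * (R - 2 * C - 2 * η) ≤ Dist.dist (f u) (f v) := by
  obtain ⟨p, hp, hlen⟩ := hG.exists_path_of_dist u v
  have key := h.mul_le_dist hη hC hR (fun i => f (p.getVert i)) p.length
    (fun i hi => hf _ _ (p.adj_getVert_succ hi))
    (fun i hi => hturn _ _ _ (p.adj_getVert_succ (by omega)).symm (p.adj_getVert_succ hi)
      (fun e => absurd (hp.getVert_injOn (by simp; omega) (by simp; omega) e) (by omega)))
  simp only [Walk.getVert_zero, Walk.getVert_length] at key
  rwa [hlen] at key

end Tree

section MetricGraph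

variable {V : Type*} {G : SimpleGraph V} (hG : G.Connected)

/-- The path distance of two vertices is their graph distance. -/
theorem MetricGraph.dist_mk_zero (e e' : G.Dart) :
    Dist.dist (SeparationQuotient.mk (⟨e, 0⟩ : EdgePoint G hG))
      (SeparationQuotient.mk (⟨e', 0⟩ : EdgePoint G hG)) = G.dist e.fst e'.fst := by
  rw [SeparationQuotient.dist_mk]
  change EdgePoint.pathDist _ _ = _
  by_cases h : e = e'
  · subst h
    simp [EdgePoint.pathDist_same]
  by_cases h' : e = e'.symm
  · subst h'
    have h1 : (G.dist e'.snd e'.fst : ℝ) = 1 := mod_cast dist_eq_one_iff_adj.2 e'.adj.symm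
    simp [EdgePoint.pathDist, e'.symm_ne, h1]
  · rw [EdgePoint.pathDist_far h h']
    have hv : ∀ w, (⟨e, 0⟩ : EdgePoint G hG).toVertex w = G.dist e.fst w := by
      intro w
      have h1 : (G.dist e.fst w : ℝ) ≤ 1 + G.dist e.snd w := by
        have := hG.dist_triangle (u := e.fst) (v := e.snd) (w := w)
        rw [dist_eq_one_iff_adj.2 e.adj] at this
        exact_mod_cast this
      simp [EdgePoint.toVertex, h1]
    have h2 : (G.dist e.fst e'.fst : ℝ) ≤ G.dist e.fst e'.snd + 1 := by
      have := hG.dist_triangle (u := e.fst) (v := e'.snd) (w := e'.fst)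
      rw [dist_eq_one_iff_adj.2 e'.adj.symm] at this
      exact_mod_cast this
    rw [hv, hv]
    simp [h2]

/-- A choice of a vertex near every point of a metric graph, which fixes the vertices. -/
theorem MetricGraph.exists_nearest_vertex :
    ∃ ν : G.MetricGraph hG → V,
      (∀ e : G.Dart, ν (SeparationQuotient.mk (⟨e, 0⟩ : EdgePoint G hG)) = e.fst) ∧
      ∀ x y, |Dist.dist x y - G.dist (ν x) (ν y)| ≤ 2 := by
  have hex : ∀ x : G.MetricGraph hG, ∃ e : G.Dart,
      Dist.dist x (SeparationQuotient.mk (⟨e, 0⟩ : EdgePoint G hG)) ≤ 1 ∧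
      (x ∈ MetricGraph.vertices G hG → x = SeparationQuotient.mk (⟨e, 0⟩ : EdgePoint G hG)) := by
    intro x
    by_cases hx : x ∈ MetricGraph.vertices G hG
    · obtain ⟨e, rfl⟩ := hx
      exact ⟨e, by simp, fun _ => rfl⟩
    · obtain ⟨p, rfl⟩ := SeparationQuotient.surjective_mk x
      refine ⟨p.edge, ?_, fun h => absurd h hx⟩
      rw [SeparationQuotient.dist_mk]
      change EdgePoint.pathDist _ _ ≤ 1
      rw [EdgePoint.pathDist_same (by rfl)]
      simpa [abs_of_nonneg p.pos.2.1] using p.pos.2.2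
  choose d hd hdv using hex
  refine ⟨fun x => (d x).fst, fun e => ?_, fun x y => ?_⟩
  · have h1 := hdv _ ⟨e, rfl⟩
    have h2 := MetricGraph.dist_mk_zero hG e
      (d (SeparationQuotient.mk (⟨e, 0⟩ : EdgePoint G hG)))
    rw [← h1, _root_.dist_self] at h2
    exact (hG.dist_eq_zero_iff.1 (by exact_mod_cast h2.symm)).symm
  · rw [← MetricGraph.dist_mk_zero hG]
    have h1 := abs_dist_sub_le x (SeparationQuotient.mk (⟨d x, 0⟩ : EdgePoint G hG)) y
    have h2 := abs_dist_sub_le y (SeparationQuotient.mk (⟨d y, 0⟩ : EdgePoint G hG))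
      (SeparationQuotient.mk (⟨d x, 0⟩ : EdgePoint G hG))
    rw [_root_.dist_comm y, _root_.dist_comm (SeparationQuotient.mk (⟨d y, 0⟩ : EdgePoint G hG))] at h2
    have h3 := hd x
    have h4 := hd y
    rw [abs_le] at h1 h2 ⊢
    constructor <;> linarith

end MetricGraph

end SimpleGraph

universe u v

/-! ### Quasi-isometrically embedded trees -/

/-- If every point of a proper hyperbolic space is near a barycenter of an ideal triangle, then the
vertices of a trivalent tree can be mapped to it, one of them to a prescribed point, so that
distances are expanded at least by any prescribed factor `s` and at most by `s` plus a constant. -/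
theorem IsHyperbolic.exists_expanding_map {X : Type*} [MetricSpace X] [ProperSpace X] {δ D L s : ℝ}
    (hδ : 0 ≤ δ) (hD : 0 ≤ D) (hL : 0 ≤ L) (hs : 0 < s) (hX : IsHyperbolic X δ)
    (hbary : ∀ x : X, ∃ ξ b, IsBarycenter D ξ b ∧ dist x b ≤ L)
    {V : Type*} {G : SimpleGraph V} (hG : G.IsTrivalentTree) (r : V) (x₀ : X) :
    ∃ f : V → X, f r = x₀ ∧ ∀ u v, G.dist u v * s ≤ dist (f u) (f v) ∧
      dist (f u) (f v) ≤ (s + 2 * D + 2 * L + 24 * δ) * G.dist u v := by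
  have h4 := hX.fourPointCondition
  set R := s + 2 * D + 2 * L + 24 * δ with hR
  set C := D + L + 6 * δ + 3 * δ with hC
  have hR0 : 0 ≤ R := by positivity
  have htripod : ∀ x : X, ∃ q : Fin 3 → X, (∀ i, dist x (q i) = R) ∧
      ∀ i j, i ≠ j → gromovProduct x (q i) (q j) ≤ D + L + 6 * δ := by
    intro x
    obtain ⟨ξ, b, hb, hxb⟩ := hbary x
    exact hb.exists_tripod hδ hX hxb hR0
  obtain ⟨e, he⟩ := hG.exists_label
  obtain ⟨f, hfr, hf⟩ := hG.1.exists_map_of_stars e r x₀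
    (fun x q => (∀ i, dist x (q i) = R) ∧ ∀ i j, i ≠ j → gromovProduct x (q i) (q j) ≤ C)
    (by
      obtain ⟨q, hq, hq'⟩ := htripod x₀
      exact ⟨q, hq, fun i j hij => (hq' i j hij).trans (by linarith)⟩)
    (by
      rintro x q ⟨hq, -⟩ k k'
      obtain ⟨p, hp, hp'⟩ := htripod (q k)
      obtain ⟨q', h1, h2, h3⟩ := h4.exists_tripod_apply_eq (by linarith) hp hp'
        (by rw [dist_comm, hq k]) k'
      exact ⟨q', ⟨h2, h3⟩, h1⟩)
  have hadj : ∀ u v, G.Adj u v → dist (f u) (f v) = R := by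
    intro u v huv
    obtain ⟨q, ⟨hq, -⟩, hqe⟩ := hf u
    rw [← hqe v huv, hq]
  have hturn : ∀ v u w, G.Adj v u → G.Adj v w → u ≠ w →
      gromovProduct (f v) (f u) (f w) ≤ C := by
    intro v u w hu hw huw
    obtain ⟨q, ⟨-, hq⟩, hqe⟩ := hf v
    rw [← hqe u hu, ← hqe w hw]
    exact hq _ _ ((he v).ne hu hw huw)
  refine ⟨f, hfr, fun u v => ⟨?_, hG.1.connected.dist_map_le hadj u v⟩⟩
  have key := hG.1.connected.mul_dist_le_dist_map h4 (by linarith) (by positivity)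
    (by linarith) hadj hturn u v
  rwa [show R - 2 * C - 2 * (3 * δ) = s by rw [hR, hC]; ring] at key

theorem theorem3p2 (D : ℝ → ℝ) :
    ∃ K : ℝ → ℝ → ℝ, ∀ δ L : ℝ, 0 ≤ δ → 0 ≤ L → 1 ≤ K δ L ∧
      ∀ (X : Type u) [MetricSpace X] [ProperSpace X] (_ : IsHyperbolic X δ)
        (Bary : BoundaryTriple X → X) (_ : IsBarycenterMap (D δ) Bary)
        (_ : CoarselySurjective L Bary)
        (V : Type v) (G : SimpleGraph V) (hG : G.IsTrivalentTree) (x₀ : X),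
        ∃ φ : G.MetricGraph hG.1.connected → X,
          IsQIEmbedding (K δ L) φ ∧
          (∃ v₀ ∈ SimpleGraph.MetricGraph.vertices G hG.1.connected, φ v₀ = x₀) ∧
          Set.InjOn φ (SimpleGraph.MetricGraph.vertices G hG.1.connected) ∧
          (∀ a ∈ SimpleGraph.MetricGraph.vertices G hG.1.connected,
            ∀ b ∈ SimpleGraph.MetricGraph.vertices G hG.1.connected, a ≠ b →
              Disjoint (Bary ⁻¹' {φ a}) (Bary ⁻¹' {φ b}) ∧
              Disjoint {ξ | IsBarycenter (D δ) ξ (φ a)} {ξ | IsBarycenter (D δ) ξ (φ b)}) ∧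
          (∃ ξ : G.MetricGraph hG.1.connected → BoundaryTriple X,
            (∀ a ∈ SimpleGraph.MetricGraph.vertices G hG.1.connected,
              dist (φ a) (Bary (ξ a)) ≤ L) ∧
            Set.InjOn (fun a => Bary (ξ a))
              (SimpleGraph.MetricGraph.vertices G hG.1.connected)) := by
  -- `s` is the expansion factor on vertices: it exceeds `2 * L` and the distance of two barycenters
  -- of one triangle. A negative `D δ` admits no barycenters, but `K δ L ≥ 1` is required anyway.
  let s : ℝ → ℝ → ℝ := fun δ L => 1 + 2 * L + 2 * max (D δ) 0 + 18 * δ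
  let R : ℝ → ℝ → ℝ := fun δ L => s δ L + 2 * max (D δ) 0 + 2 * L + 24 * δ
  refine ⟨fun δ L => 2 * R δ L, fun δ L hδ hL => ?_⟩
  have hD : 0 ≤ max (D δ) 0 := le_max_right _ _
  have hDle : D δ ≤ max (D δ) 0 := le_max_left _ _
  have hs : 1 + 2 * L + 2 * max (D δ) 0 + 18 * δ = s δ L := rfl
  have hs1 : 1 ≤ s δ L := by linarith
  have hR : s δ L + 2 * max (D δ) 0 + 2 * L + 24 * δ = R δ L := rfl
  have hR1 : 1 ≤ R δ L := by linarith
  refine ⟨by linarith, ?_⟩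
  intro X _ _ hX Bary hBary hsurj V G hG x₀
  have hbary : ∀ x : X, ∃ ξ b, IsBarycenter (max (D δ) 0) ξ b ∧ dist x b ≤ L := by
    intro x
    obtain ⟨ξ, hξ⟩ := hsurj x
    refine ⟨ξ, Bary ξ, fun i j hij β hβ => ?_, hξ⟩
    obtain ⟨t, ht⟩ := hBary ξ i j hij β hβ
    exact ⟨t, ht.trans hDle⟩
  obtain ⟨r⟩ := hG.1.connected.nonempty
  obtain ⟨f, hfr, hf⟩ := hX.exists_expanding_map hδ hD hL (by linarith : 0 < s δ L) hbary hG r x₀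
  rw [hR] at hf
  obtain ⟨ν, hν, hνd⟩ := SimpleGraph.MetricGraph.exists_nearest_vertex hG.1.connected
  have hsep : ∀ a ∈ SimpleGraph.MetricGraph.vertices G hG.1.connected,
      ∀ b ∈ SimpleGraph.MetricGraph.vertices G hG.1.connected, a ≠ b →
        s δ L ≤ dist (f (ν a)) (f (ν b)) := by
    rintro _ ⟨e, rfl⟩ _ ⟨e', rfl⟩ hne
    have h1 := (hf e.fst e'.fst).1
    rw [hν, hν]
    have h2 : (1 : ℝ) ≤ G.dist e.fst e'.fst := by
      rw [Nat.one_le_cast, Nat.one_le_iff_ne_zero]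
      intro h0
      apply hne
      rw [← dist_eq_zero, SimpleGraph.MetricGraph.dist_mk_zero, h0,
        Nat.cast_zero]
    nlinarith
  choose ξ hξ using hsurj
  refine ⟨fun x => f (ν x), fun x y => ?_, ?_, ?_, ?_, fun x => ξ (f (ν x)), fun a _ => hξ _, ?_⟩
  · have h1 := abs_le.1 (hνd x y)
    obtain ⟨h2, h3⟩ := hf (ν x) (ν y)
    have h4 : (0 : ℝ) ≤ G.dist (ν x) (ν y) := Nat.cast_nonneg _
    have h5 : (0 : ℝ) ≤ dist x y := dist_nonneg
    constructor
    · have h6 : 1 / (2 * R δ L) * dist x y ≤ dist x y :=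
        mul_le_of_le_one_left h5 ((div_le_one (by linarith)).2 (by linarith))
      nlinarith
    · nlinarith
  · obtain ⟨u, hu⟩ := hG.exists_adj r
    exact ⟨_, ⟨⟨(r, u), hu⟩, rfl⟩, by dsimp only; rw [hν, hfr]⟩
  · intro a ha b hb hab
    by_contra hne
    have h1 := hsep a ha b hb hne
    dsimp only at hab
    rw [hab, dist_self] at h1
    linarith
  · intro a ha b hb hne
    have h1 := hsep a ha b hb hne
    have hdisj : Disjoint {ξ | IsBarycenter (D δ) ξ (f (ν a))}
        {ξ | IsBarycenter (D δ) ξ (f (ν b))} := by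
      refine Set.disjoint_left.2 fun ζ hζa hζb => ?_
      have := IsBarycenter.dist_le hδ hX hζa hζb
      linarith
    have hpre : ∀ x, Bary ⁻¹' {x} ⊆ {ξ | IsBarycenter (D δ) ξ x} := by
      rintro _ ζ rfl
      exact hBary ζ
    exact ⟨hdisj.mono (hpre _) (hpre _), hdisj⟩
  · intro a ha b hb hab
    by_contra hne
    have h1 := hsep a ha b hb hne
    have h2 := dist_triangle_right (f (ν a)) (f (ν b)) (Bary (ξ (f (ν a))))
    have h3 := hξ (f (ν a))
    have h4 := hξ (f (ν b))
    dsimp only at hab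
    rw [← hab] at h4
    linarith
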